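/- Let $\kappa$ and $\mu$ be (infinite) regular cardinals. For cardinals $\alpha,\beta,\gamma$, a poset $R$ has the $(\alpha,\beta,\gamma)$-chain condition if every $A\subseteq R$ of size $\alpha$ has a subset $B\subseteq A$ of size $\beta$ such that every $X\subseteq B$ of size $\gamma$ has a lower bound in $R$. A complete Boolean algebra is regarded as a forcing poset by means of its nonzero elements with the induced order. A map $\tau:P\to Q$ of posets is a complete embedding if it is order preserving, satisfies $\tau(p)\parallel\tau(p')\iff p\parallel p'$ (where $\parallel$ denotes compatibility), and for every $q\in Q$ there is $p\in P$ such that $\tau(p')\parallel q$ for all $p'\le p$. **Lemma 4.4.** Let $P,Q$ be complete Boolean algebras and let $\tau:P\to Q$ be a complete embedding. Suppose that $Q$ has the $(\kappa,\mu,\mu)$-chain condition. Then $$P\Vdash\ Q/\dot G\ \text{has the } (\kappa,\mu,\mu)\text{-chain condition},$$ where $\dot G$ is the canonical name of the generic filter of $P$ and, in the extension, $Q/\dot G=\{q\in Q \mid \forall p\in\dot G\ (\tau(p)\parallel q)\}$, ordered by $\le_Q$. (In the extension, "of size $\kappa$" and "of size $\mu$" mean equinumerous with the ground model ordinals $\kappa$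 and $\mu$.) -/

import Mathlib

universe u

/-! ### Posets, chain conditions, complete embeddings -/

namespace Forcing

/-- The forcing poset attached to a Boolean algebra: its nonzero elements, with the induced order. -/
abbrev Cond (B : Type u) [CompleteBooleanAlgebra B] : Type u := {b : B // b ≠ ⊥}

/-- Compatibility `p ∥ q` in a poset: there is a common lower bound. -/
def Compat {R : Type u} [Preorder R] (p q : R) : Prop := ∃ r, r ≤ p ∧ r ≤ q

/-- The `(α, β, γ)`-chain condition of a poset: every subset `A` of size `α` has a subset `B` of
size `β` all of whose subsets of size `γ` have a lower bound in the poset. -/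
def HasCC (R : Type u) [Preorder R] (α β γ : Cardinal.{u}) : Prop :=
  ∀ A : Set R, Cardinal.mk A = α →
    ∃ B ⊆ A, Cardinal.mk B = β ∧
      ∀ X ⊆ B, Cardinal.mk X = γ → ∃ r : R, ∀ x ∈ X, r ≤ x

/-- Complete embeddings of posets: order preserving, preserving compatibility and incompatibility,
and every `q` has a reduct `p`, that is, `τ p'` is compatible with `q` for all `p' ≤ p`. -/
structure IsCompleteEmbedding {R S : Type u} [Preorder R] [Preorder S] (τ : R → S) : Prop where
  mono : ∀ p p', p ≤ p' → τ p ≤ τ p'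
  compat_iff : ∀ p p', Compat (τ p) (τ p') ↔ Compat p p'
  exists_reduct : ∀ q : S, ∃ p : R, ∀ p' ≤ p, Compat (τ p') q

/-! ### Names and the Boolean-valued model

The ground model `V` is `ZFSet.{u}`. For a complete Boolean algebra `B : Type u`, `BName B` is the
class of `B`-names, and a sentence of the forcing language is given by its Boolean value in `B`,
computed in the usual way: `⊓`, `⇨`, `bihimp` (biconditional) for the connectives, `⨅`, `⨆` over all names for the
quantifiers. -/

/-- `B`-names: sets of pairs (name, Boolean value), indexed by a small type. -/
inductive BName (B : Type u) : Type (u + 1)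
  | mk (ι : Type u) (nm : ι → BName B) (val : ι → B) : BName B

namespace BName

variable {B : Type u} [CompleteBooleanAlgebra B]

/-- The Boolean value of `x = y`. -/
def eqVal : BName B → BName B → B
  | mk ι a b, mk κ c d =>
    (⨅ i : ι, b i ⇨ ⨆ j : κ, d j ⊓ eqVal (a i) (c j)) ⊓
      (⨅ j : κ, d j ⇨ ⨆ i : ι, b i ⊓ eqVal (a i) (c j))

/-- The Boolean value of `x ∈ y`. -/
def memVal (x : BName B) : BName B → B
  | mk ι a b => ⨆ i : ι, b i ⊓ eqVal x (a i)

/-- The Boolean value of `x ⊆ y`. -/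
def subVal (x y : BName B) : B := ⨅ z : BName B, memVal z x ⇨ memVal z y

/-- The canonical name `{x, y}` for the unordered pair. -/
def upair (x y : BName B) : BName B :=
  mk (ULift.{u} Bool) (fun i => if i.down then x else y) (fun _ => ⊤)

/-- The canonical name for the (Kuratowski) ordered pair `(x, y) = {{x}, {x, y}}`. -/
def opair (x y : BName B) : BName B := upair (upair x x) (upair x y)

/-- The check name `x̌ = {(y̌, 1) : y ∈ x}` of a ground model set `x`. -/
noncomputable def check (x : ZFSet.{u}) : BName B :=
  mk (Shrink.{u} {y : ZFSet.{u} // y ∈ x})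
    (fun i => check ((equivShrink {y : ZFSet.{u} // y ∈ x}).symm i).1) (fun _ => ⊤)
termination_by x
decreasing_by exact ((equivShrink {y // y ∈ x}).symm i).2

/-- The canonical name for the set `{z ∈ x | φ z}`. -/
def sep (φ : BName B → B) : BName B → BName B
  | mk ι a b => mk ι a (fun i => b i ⊓ φ (a i))

/-- The Boolean value of "`f` is a bijection from `x` onto `y`". -/
noncomputable def bijVal (f x y : BName B) : B :=
  (⨅ z : BName B, memVal z f ⇨
      ⨆ a : BName B, ⨆ b : BName B, memVal a x ⊓ memVal b y ⊓ eqVal z (opair a b)) ⊓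
  (⨅ a : BName B, memVal a x ⇨ ⨆ b : BName B, memVal b y ⊓ memVal (opair a b) f) ⊓
  (⨅ b : BName B, memVal b y ⇨ ⨆ a : BName B, memVal a x ⊓ memVal (opair a b) f) ⊓
  (⨅ a : BName B, ⨅ b : BName B, ⨅ a' : BName B, ⨅ b' : BName B,
    (memVal (opair a b) f ⊓ memVal (opair a' b') f) ⇨ bihimp (eqVal a a') (eqVal b b'))

/-- The Boolean value of "`x` has the size of the ground model cardinal `α`": there is a bijection
from (the check name of) the von Neumann ordinal `α` onto `x`. -/
noncomputable def sizeVal (α : Cardinal.{u}) (x : BName B) : B :=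
  ⨆ f : BName B, bijVal f (check α.ord.toZFSet) x

/-- The Boolean value of "the set `R` ordered by `le` has the `(α, β, γ)`-chain condition". -/
noncomputable def ccVal (R le : BName B) (α β γ : Cardinal.{u}) : B :=
  ⨅ A : BName B, (subVal A R ⊓ sizeVal α A) ⇨
    ⨆ Y : BName B, subVal Y A ⊓ sizeVal β Y ⊓
      ⨅ X : BName B, (subVal X Y ⊓ sizeVal γ X) ⇨
        ⨆ r : BName B, memVal r R ⊓ ⨅ x : BName B, memVal x X ⇨ memVal (opair r x) le

/-- The Boolean value of "`x` and `y` are compatible in the set `R` ordered by `le`". -/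
noncomputable def compatVal (R le x y : BName B) : B :=
  ⨆ r : BName B, memVal r R ⊓ memVal (opair r x) le ⊓ memVal (opair r y) le

/-- The canonical name for the quotient `R / F = {q ∈ R | ∀ p ∈ F, p ∥ q}`, where `R` is ordered
by `le`. (It is again ordered by `le`.) -/
noncomputable def quotient (R le F : BName B) : BName B :=
  sep (fun q => ⨅ p : BName B, memVal p F ⇨ compatVal R le p q) R

/-- The canonical name `{(h(p)ˇ, p) : p ∈ B⁺}` for the image `h '' G` of the generic filter `G`
under a ground model function `h`. -/
noncomputable def genericImage (h : Cond B → ZFSet.{u}) : BName B :=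
  mk (Cond B) (fun p => check (h p)) (fun p => p.1)

end BName

/-- The condition `p` forces the sentence with Boolean value `φ`. -/
def Forces {B : Type u} [CompleteBooleanAlgebra B] (p : Cond B) (φ : B) : Prop := p.1 ≤ φ

/-! ### Ground model posets as sets -/

/-- The underlying set of a poset `R`, whose elements are realised as sets through `c`. -/
noncomputable def carrierSet {R : Type u} (c : R ↪ ZFSet.{u}) : ZFSet.{u} :=
  ZFSet.range (fun r : R => c r)

/-- The order relation of a poset `R`, whose elements are realised as sets through `c`: the set of
all ordered pairs `(r, s)` with `r ≤ s`. -/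
noncomputable def orderSet {R : Type u} [Preorder R] (c : R ↪ ZFSet.{u}) : ZFSet.{u} :=
  ZFSet.range (fun z : {z : R × R // z.1 ≤ z.2} => ZFSet.pair (c z.1.1) (c z.1.2))

end Forcing

/-!
The argument takes place in the ground model, below a condition `b` forcing that `f` is a bijection
of `κ` onto a subset `A` of the quotient. For each `i < κ` some condition `s i ≤ b` decides the value
of `f` at `i` to be `q i`. As `s i` forces `q i` into the quotient, `τ (s i)` and `q i` have a common
lower bound `r i`. The chain condition of `Q` applied to the conditions `r i` yields a set `I` of
`μ` many indices and a common lower bound `t` of all `r i` with `i ∈ I`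
(`HasCC.exists_bounded_subfamily`). This uses the regularity of `κ`, since `r` need not be
injective: if `r` takes fewer than `κ` values, it is constant on `κ` many indices.

Let `p'` be a reduct of `t`. By separativity `p' ≤ s i` for all `i ∈ I`
(`IsCompleteEmbedding.le_of_reduct`), because `t ≤ r i ≤ τ (s i)`. So `p'` forces `f` to take the
value `q i` at each `i ∈ I`; in particular these values are distinct, and the ground model set
`{q i | i ∈ I}` is forced to be a subset of `A` of size `μ`. It is bounded below by `t`, which `p'`
forces into the quotient (`le_memVal_quotientName`), so that `t` bounds all its subsets in the
extension. Conditions like `p'` are dense below the value of "`A` is a subset of the quotient of size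
`κ`", which gives the claim (`le_of_dense`).

The rest is the calculus of Boolean values: equality is a congruence for membership and pairs,
atomic sentences about check names have value `⊤` or `⊥` according to their truth, and ground model
bijections remain bijections. Statements are mostly given in the form `Γ ≤ φ`, read as "`Γ` forces
`φ`", so that they compose like deductions from the context `Γ`.
-/

namespace Forcing

/-! ### Reasoning below a Boolean value -/

section Entailment

variable {B : Type u} [CompleteBooleanAlgebra B]

theorem le_of_le_iSup {ι : Sort*} {a c : B} {f : ι → B} (h : a ≤ ⨆ i, f i)
    (hf : ∀ i, a ⊓ f i ≤ c) : a ≤ c := by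
  calc a ≤ a ⊓ ⨆ i, f i := le_inf le_rfl h
    _ = ⨆ i, a ⊓ f i := inf_iSup_eq _ _
    _ ≤ c := iSup_le hf

theorem le_of_le_sup {a b b' c : B} (h : a ≤ b ⊔ b') (hb : a ⊓ b ≤ c) (hb' : a ⊓ b' ≤ c) :
    a ≤ c := by
  calc a ≤ a ⊓ (b ⊔ b') := le_inf le_rfl h
    _ = a ⊓ b ⊔ a ⊓ b' := inf_sup_left _ _ _
    _ ≤ c := sup_le hb hb'

theorem le_of_le_himp {a b c : B} (h : a ≤ b ⇨ c) (hb : a ≤ b) : a ≤ c :=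
  (le_inf le_rfl hb).trans (le_himp_iff.1 h)

theorem exists_inf_ne_bot {ι : Sort*} {a : B} {f : ι → B} (ha : a ≠ ⊥) (h : a ≤ ⨆ i, f i) :
    ∃ i, a ⊓ f i ≠ ⊥ := by
  by_contra! hf
  exact ha (le_bot_iff.1 (le_of_le_iSup h fun i => (hf i).le))

/-- Density argument: a sentence implies another one as soon as every condition forcing the first
has an extension forcing the second. -/
theorem le_of_dense {a c : B} (h : ∀ b : B, b ≠ ⊥ → b ≤ a → ∃ b' ≤ b, b' ≠ ⊥ ∧ b' ≤ c) :
    a ≤ c := by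
  by_contra hac
  obtain ⟨b, hb, hb0, hbc⟩ := h (a \ c) (fun h0 => hac (sdiff_eq_bot_iff.1 h0)) sdiff_le
  exact hb0 (le_bot_iff.1 (disjoint_sdiff_self_left hb hbc))

theorem compat_iff_inf_ne_bot {p q : Cond B} : Compat p q ↔ p.1 ⊓ q.1 ≠ ⊥ := by
  constructor
  · rintro ⟨r, hp, hq⟩ h
    exact r.2 (le_bot_iff.1 ((le_inf hp hq : r.1 ≤ p.1 ⊓ q.1).trans h.le))
  · exact fun h => ⟨⟨_, h⟩, inf_le_left, inf_le_right⟩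

end Entailment

namespace BName

variable {B : Type u} [CompleteBooleanAlgebra B]

/-! ### Equality and membership in the Boolean-valued model -/

theorem eqVal_refl (x : BName B) : eqVal x x = ⊤ := by
  induction x with
  | mk ι a b ih =>
    rw [eqVal, eq_top_iff]
    refine le_inf (le_iInf fun i => ?_) (le_iInf fun i => ?_) <;>
      exact le_himp_iff.2 (inf_le_right.trans
        (le_iSup_of_le i (le_inf le_rfl (by rw [ih]; exact le_top))))

theorem eqVal_comm (x y : BName B) : eqVal x y = eqVal y x := by
  induction x generalizing y with
  | mk ι a b ih =>
    obtain ⟨κ, c, d⟩ := y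
    rw [eqVal, eqVal, inf_comm]
    simp only [ih]

theorem eqVal_trans_le (x y z : BName B) : eqVal x y ⊓ eqVal y z ≤ eqVal x z := by
  induction x generalizing y z with
  | mk ι a b ih =>
    obtain ⟨κ, c, d⟩ := y
    obtain ⟨l, e, f⟩ := z
    set Γ : B := eqVal (mk ι a b) (mk κ c d) ⊓ eqVal (mk κ c d) (mk l e f) with hΓ
    have h1 : Γ ≤ _ := inf_le_left
    have h2 : Γ ≤ _ := inf_le_right
    rw [eqVal] at h1 h2 ⊢
    refine le_inf (le_iInf fun i => le_himp_iff.2 ?_) (le_iInf fun k => le_himp_iff.2 ?_)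
    · have h3 := le_himp_iff.1 ((h1.trans inf_le_left).trans (iInf_le _ i))
      refine le_of_le_iSup h3 fun j => ?_
      have h4 := le_himp_iff.1 ((h2.trans inf_le_left).trans (iInf_le _ j))
      refine le_of_le_iSup (le_trans ?_ h4) fun k => le_iSup_of_le k ?_
      · exact le_inf (inf_le_left.trans inf_le_left) (inf_le_right.trans inf_le_left)
      · refine le_inf (inf_le_right.trans inf_le_left) (le_trans (le_inf ?_ ?_) (ih i (c j) (e k)))
        · exact inf_le_left.trans (inf_le_right.trans inf_le_right)
        · exact inf_le_right.trans inf_le_right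
    · have h3 := le_himp_iff.1 ((h2.trans inf_le_right).trans (iInf_le _ k))
      refine le_of_le_iSup h3 fun j => ?_
      have h4 := le_himp_iff.1 ((h1.trans inf_le_right).trans (iInf_le _ j))
      refine le_of_le_iSup (le_trans ?_ h4) fun i => le_iSup_of_le i ?_
      · exact le_inf (inf_le_left.trans inf_le_left) (inf_le_right.trans inf_le_left)
      · refine le_inf (inf_le_right.trans inf_le_left) (le_trans (le_inf ?_ ?_) (ih i (c j) (e k)))
        · exact inf_le_right.trans inf_le_right
        · exact inf_le_left.trans (inf_le_right.trans inf_le_right)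

theorem le_eqVal_refl {Γ : B} (x : BName B) : Γ ≤ eqVal x x := by
  rw [eqVal_refl]; exact le_top

theorem le_eqVal_symm {Γ : B} {x y : BName B} (h : Γ ≤ eqVal x y) : Γ ≤ eqVal y x :=
  h.trans (eqVal_comm x y).le

theorem le_eqVal_trans {Γ : B} {x y z : BName B} (h : Γ ≤ eqVal x y) (h' : Γ ≤ eqVal y z) :
    Γ ≤ eqVal x z :=
  (le_inf h h').trans (eqVal_trans_le x y z)

theorem memVal_congr_left {Γ : B} {x x' y : BName B} (h : Γ ≤ eqVal x x') (hx : Γ ≤ memVal x y) :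
    Γ ≤ memVal x' y := by
  obtain ⟨ι, a, b⟩ := y
  rw [memVal] at hx ⊢
  refine le_of_le_iSup hx fun i => le_iSup_of_le i (le_inf (inf_le_right.trans inf_le_left) ?_)
  exact le_eqVal_trans (le_eqVal_symm (inf_le_left.trans h)) (inf_le_right.trans inf_le_right)

theorem memVal_congr_right {Γ : B} {x y y' : BName B} (h : Γ ≤ eqVal y y')
    (hx : Γ ≤ memVal x y) : Γ ≤ memVal x y' := by
  obtain ⟨ι, a, b⟩ := y
  obtain ⟨κ, c, d⟩ := y'
  rw [memVal] at hx ⊢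
  rw [eqVal] at h
  refine le_of_le_iSup hx fun i => ?_
  have h1 := le_himp_iff.1 ((h.trans inf_le_left).trans (iInf_le _ i))
  refine le_of_le_iSup (le_trans (inf_le_inf_left _ inf_le_left) h1) fun j => le_iSup_of_le j ?_
  exact le_inf (inf_le_right.trans inf_le_left) (le_eqVal_trans
    (inf_le_left.trans (inf_le_right.trans inf_le_right)) (inf_le_right.trans inf_le_right))

/-- Extensionality in the Boolean-valued model. -/
theorem le_eqVal_of_forall_mem {Γ : B} {x y : BName B}
    (h : ∀ z, Γ ⊓ memVal z x ≤ memVal z y) (h' : ∀ z, Γ ⊓ memVal z y ≤ memVal z x) :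
    Γ ≤ eqVal x y := by
  obtain ⟨ι, a, b⟩ := x
  obtain ⟨κ, c, d⟩ := y
  simp only [memVal] at h h'
  rw [eqVal]
  refine le_inf (le_iInf fun i => le_himp_iff.2 ?_) (le_iInf fun j => le_himp_iff.2 ?_)
  · exact le_trans (inf_le_inf_left _ (le_iSup_of_le i (le_inf le_rfl (le_eqVal_refl _)))) (h (a i))
  · refine le_trans (le_trans
      (inf_le_inf_left _ (le_iSup_of_le j (le_inf le_rfl (le_eqVal_refl _)))) (h' (c j))) ?_
    simp only [eqVal_comm (c j)]
    exact le_rfl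

theorem subVal_elim {Γ : B} {x y : BName B} (h : Γ ≤ subVal x y) {z : BName B}
    (hz : Γ ≤ memVal z x) : Γ ≤ memVal z y :=
  le_of_le_himp (h.trans (iInf_le _ z)) hz

/-! ### Unordered and ordered pairs -/

theorem memVal_upair (z x y : BName B) : memVal z (upair x y) = eqVal z x ⊔ eqVal z y := by
  rw [upair, memVal, ← Equiv.ulift.symm.iSup_comp, iSup_bool_eq]
  simp

theorem upair_congr {Γ : B} {x x' y y' : BName B} (hx : Γ ≤ eqVal x x') (hy : Γ ≤ eqVal y y') :
    Γ ≤ eqVal (upair x y) (upair x' y') := by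
  refine le_eqVal_of_forall_mem (fun z => ?_) (fun z => ?_) <;> simp only [memVal_upair]
  · refine le_of_le_sup inf_le_right (le_sup_of_le_left ?_) (le_sup_of_le_right ?_)
    · exact le_eqVal_trans inf_le_right (inf_le_left.trans (inf_le_left.trans hx))
    · exact le_eqVal_trans inf_le_right (inf_le_left.trans (inf_le_left.trans hy))
  · refine le_of_le_sup inf_le_right (le_sup_of_le_left ?_) (le_sup_of_le_right ?_)
    · exact le_eqVal_trans inf_le_right (le_eqVal_symm (inf_le_left.trans (inf_le_left.trans hx)))
    · exact le_eqVal_trans inf_le_right (le_eqVal_symm (inf_le_left.trans (inf_le_left.trans hy)))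

theorem opair_congr {Γ : B} {x x' y y' : BName B} (hx : Γ ≤ eqVal x x') (hy : Γ ≤ eqVal y y') :
    Γ ≤ eqVal (opair x y) (opair x' y') :=
  upair_congr (upair_congr hx hx) (upair_congr hx hy)

theorem le_of_eqVal_upair_left {Γ : B} {a b c d : BName B}
    (h : Γ ≤ eqVal (upair a b) (upair c d)) : Γ ≤ eqVal a c ⊔ eqVal a d := by
  rw [← memVal_upair]
  exact memVal_congr_right h (by rw [memVal_upair]; exact le_sup_of_le_left (le_eqVal_refl a))

theorem le_of_eqVal_upair_right {Γ : B} {a b c d : BName B}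
    (h : Γ ≤ eqVal (upair a b) (upair c d)) : Γ ≤ eqVal b c ⊔ eqVal b d := by
  rw [← memVal_upair]
  exact memVal_congr_right h (by rw [memVal_upair]; exact le_sup_of_le_right (le_eqVal_refl b))

theorem eqVal_of_upair_self {Γ : B} {a c d : BName B}
    (h : Γ ≤ eqVal (upair a a) (upair c d)) : Γ ≤ eqVal a c := by
  have := le_of_eqVal_upair_left (le_eqVal_symm h)
  rw [sup_idem] at this
  exact le_eqVal_symm this

theorem eqVal_of_upair_of_left {Γ : B} {a b c d : BName B}
    (h : Γ ≤ eqVal (upair a b) (upair c d)) (hac : Γ ≤ eqVal a c) : Γ ≤ eqVal b d := by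
  refine le_of_le_sup (le_of_eqVal_upair_right h) ?_ inf_le_right
  refine le_of_le_sup (inf_le_left.trans (le_of_eqVal_upair_right (le_eqVal_symm h))) ?_
    (le_eqVal_symm inf_le_right)
  exact le_eqVal_trans (inf_le_left.trans inf_le_right) (le_eqVal_trans
    (le_eqVal_symm (inf_le_left.trans (inf_le_left.trans hac))) (le_eqVal_symm inf_le_right))

theorem eqVal_fst_of_opair {Γ : B} {a b c d : BName B}
    (h : Γ ≤ eqVal (opair a b) (opair c d)) : Γ ≤ eqVal a c :=
  le_of_le_sup (le_of_eqVal_upair_left h) (eqVal_of_upair_self inf_le_right)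
    (eqVal_of_upair_self inf_le_right)

theorem eqVal_snd_of_opair {Γ : B} {a b c d : BName B}
    (h : Γ ≤ eqVal (opair a b) (opair c d)) : Γ ≤ eqVal b d := by
  have hac := eqVal_fst_of_opair h
  exact eqVal_of_upair_of_left (eqVal_of_upair_of_left h (upair_congr hac hac)) hac

/-! ### Check names -/

theorem memVal_check (z : BName B) (x : ZFSet.{u}) :
    memVal z (check x) = ⨆ y : {y : ZFSet.{u} // y ∈ x}, eqVal z (check y.1) := by
  rw [check, memVal, ← (equivShrink {y : ZFSet.{u} // y ∈ x}).iSup_comp]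
  simp

theorem memVal_check_range {ι : Type u} (z : BName B) (f : ι → ZFSet.{u}) :
    memVal z (check (ZFSet.range f)) = ⨆ i, eqVal z (check (f i)) := by
  rw [memVal_check]
  apply le_antisymm
  · refine iSup_le fun ⟨y, hy⟩ => ?_
    obtain ⟨i, rfl⟩ := ZFSet.mem_range.1 hy
    exact le_iSup (fun i => eqVal z (check (f i))) i
  · exact iSup_le fun i => le_iSup (fun y : {y // y ∈ ZFSet.range f} => eqVal z (check y.1))
      ⟨f i, ZFSet.mem_range.2 ⟨i, rfl⟩⟩

theorem le_memVal_check {Γ : B} {x y : ZFSet.{u}} (h : x ∈ y) :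
    Γ ≤ memVal (check x) (check y) := by
  rw [memVal_check]
  exact le_iSup_of_le ⟨x, h⟩ (le_eqVal_refl _)

theorem eqVal_check_of_ne {x y : ZFSet.{u}} (h : x ≠ y) :
    eqVal (check x) (check y : BName B) = ⊥ := by
  induction x using ZFSet.inductionOn generalizing y with
  | _ x ih =>
    rw [← le_bot_iff]
    by_cases hxy : x ⊆ y
    · obtain ⟨z, hzy, hzx⟩ : ∃ z ∈ y, z ∉ x := by
        by_contra! hyx
        exact h (ZFSet.ext fun z => ⟨fun hz => hxy hz, hyx z⟩)
      have hz := memVal_congr_right (le_eqVal_symm le_rfl)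
        (le_memVal_check (Γ := eqVal (check x) (check y : BName B)) hzy)
      rw [memVal_check] at hz
      refine hz.trans (iSup_le fun w => ?_)
      have hw : w.1 ≠ z := fun hw => hzx (hw ▸ w.2)
      rw [eqVal_comm, ih w.1 w.2 hw]
    · obtain ⟨z, hzx, hzy⟩ : ∃ z ∈ x, z ∉ y := by
        by_contra! hyx
        exact hxy fun z hz => hyx z hz
      have hz := memVal_congr_right le_rfl
        (le_memVal_check (Γ := eqVal (check x) (check y : BName B)) hzx)
      rw [memVal_check] at hz
      refine hz.trans (iSup_le fun w => ?_)
      rw [ih z hzx (fun hw => hzy (hw ▸ w.2))]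

theorem eq_of_le_eqVal_check {Γ : B} (hΓ : Γ ≠ ⊥) {x y : ZFSet.{u}}
    (h : Γ ≤ eqVal (check x) (check y)) : x = y := by
  by_contra hxy
  exact hΓ (le_bot_iff.1 (h.trans (eqVal_check_of_ne hxy).le))

theorem mem_of_le_memVal_check {Γ : B} (hΓ : Γ ≠ ⊥) {x y : ZFSet.{u}}
    (h : Γ ≤ memVal (check x) (check y)) : x ∈ y := by
  rw [memVal_check] at h
  obtain ⟨w, hw⟩ := exists_inf_ne_bot hΓ h
  exact eq_of_le_eqVal_check hw inf_le_right ▸ w.2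

theorem le_eqVal_upair_check {Γ : B} (x y : ZFSet.{u}) :
    Γ ≤ eqVal (upair (check x) (check y)) (check {x, y}) := by
  refine le_eqVal_of_forall_mem (fun z => ?_) (fun z => ?_)
  · rw [memVal_upair, memVal_check]
    exact inf_le_right.trans (sup_le (le_iSup_of_le ⟨x, by simp⟩ le_rfl)
      (le_iSup_of_le ⟨y, by simp⟩ le_rfl))
  · rw [memVal_upair, memVal_check]
    refine inf_le_right.trans (iSup_le fun ⟨w, hw⟩ => ?_)
    rcases ZFSet.mem_pair.1 hw with rfl | rfl
    · exact le_sup_left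
    · exact le_sup_right

theorem le_eqVal_opair_check {Γ : B} (x y : ZFSet.{u}) :
    Γ ≤ eqVal (opair (check x) (check y)) (check (ZFSet.pair x y)) := by
  have hx : ({x, x} : ZFSet.{u}) = {x} := by ext; simp
  have h := le_eqVal_upair_check (Γ := Γ) x x
  rw [hx] at h
  exact le_eqVal_trans (upair_congr h (le_eqVal_upair_check x y)) (le_eqVal_upair_check {x} {x, y})

theorem le_memVal_opair_check {Γ : B} {x y r : ZFSet.{u}} (h : ZFSet.pair x y ∈ r) :
    Γ ≤ memVal (opair (check x) (check y)) (check r) :=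
  memVal_congr_left (le_eqVal_symm (le_eqVal_opair_check x y)) (le_memVal_check h)

theorem pair_mem_of_le_memVal {Γ : B} (hΓ : Γ ≠ ⊥) {x y r : ZFSet.{u}}
    (h : Γ ≤ memVal (opair (check x) (check y)) (check r)) : ZFSet.pair x y ∈ r :=
  mem_of_le_memVal_check hΓ (memVal_congr_left (le_eqVal_opair_check x y) h)

/-! ### Ground model bijections -/

/-- The check name of the graph of a ground model bijection is a bijection with value `⊤`. -/
theorem bijVal_check_range {ι : Type u} {e f : ι → ZFSet.{u}} (he : Function.Injective e)
    (hf : Function.Injective f) :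
    bijVal (check (ZFSet.range fun i => ZFSet.pair (e i) (f i))) (check (ZFSet.range e))
      (check (ZFSet.range f) : BName B) = ⊤ := by
  have hg : ∀ i, ZFSet.pair (e i) (f i) ∈ ZFSet.range fun i => ZFSet.pair (e i) (f i) :=
    fun i => ZFSet.mem_range.2 ⟨i, rfl⟩
  rw [eq_top_iff, bijVal]
  refine le_inf (le_inf (le_inf ?_ ?_) ?_) ?_
  · refine le_iInf fun z => le_himp_iff.2 ?_
    rw [memVal_check_range]
    refine le_of_le_iSup inf_le_right fun i =>
      le_iSup_of_le (check (e i)) (le_iSup_of_le (check (f i)) (le_inf (le_inf ?_ ?_) ?_))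
    · exact le_memVal_check (ZFSet.mem_range.2 ⟨i, rfl⟩)
    · exact le_memVal_check (ZFSet.mem_range.2 ⟨i, rfl⟩)
    · exact le_eqVal_trans inf_le_right (le_eqVal_symm (le_eqVal_opair_check _ _))
  · refine le_iInf fun a => le_himp_iff.2 ?_
    rw [memVal_check_range]
    refine le_of_le_iSup inf_le_right fun i => le_iSup_of_le (check (f i)) (le_inf ?_ ?_)
    · exact le_memVal_check (ZFSet.mem_range.2 ⟨i, rfl⟩)
    · exact memVal_congr_left (opair_congr (le_eqVal_symm inf_le_right) (le_eqVal_refl _))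
        (le_memVal_opair_check (hg i))
  · refine le_iInf fun b => le_himp_iff.2 ?_
    rw [memVal_check_range]
    refine le_of_le_iSup inf_le_right fun i => le_iSup_of_le (check (e i)) (le_inf ?_ ?_)
    · exact le_memVal_check (ZFSet.mem_range.2 ⟨i, rfl⟩)
    · exact memVal_congr_left (opair_congr (le_eqVal_refl _) (le_eqVal_symm inf_le_right))
        (le_memVal_opair_check (hg i))
  · refine le_iInf fun a => le_iInf fun b => le_iInf fun a' => le_iInf fun b' =>
      le_himp_iff.2 ?_
    simp only [memVal_check_range]
    refine le_of_le_iSup (inf_le_right.trans inf_le_left) fun i => ?_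
    refine le_of_le_iSup (inf_le_left.trans (inf_le_right.trans inf_le_right)) fun j => ?_
    set Γ : B := _ ⊓ eqVal (opair a' b') _
    have hi : Γ ≤ eqVal (opair a b) (opair (check (e i)) (check (f i))) :=
      le_eqVal_trans (inf_le_left.trans inf_le_right) (le_eqVal_symm (le_eqVal_opair_check _ _))
    have hj : Γ ≤ eqVal (opair a' b') (opair (check (e j)) (check (f j))) :=
      le_eqVal_trans inf_le_right (le_eqVal_symm (le_eqVal_opair_check _ _))
    have hai := eqVal_fst_of_opair hi
    have hbi := eqVal_snd_of_opair hi
    have haj := eqVal_fst_of_opair hj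
    have hbj := eqVal_snd_of_opair hj
    rw [le_bihimp_iff]
    by_cases hij : i = j
    · subst hij
      exact ⟨inf_le_right.trans (le_eqVal_trans hai (le_eqVal_symm haj)),
        inf_le_right.trans (le_eqVal_trans hbi (le_eqVal_symm hbj))⟩
    · -- Distinct indices have distinct components, so that both equalities have value `⊥` here.
      constructor
      · have h : eqVal b b' ⊓ Γ ≤ eqVal (check (f i)) (check (f j)) :=
          le_eqVal_trans (le_eqVal_symm (inf_le_right.trans hbi))
            (le_eqVal_trans inf_le_left (inf_le_right.trans hbj))
        rw [eqVal_check_of_ne (hf.ne hij)] at h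
        exact h.trans bot_le
      · have h : eqVal a a' ⊓ Γ ≤ eqVal (check (e i)) (check (e j)) :=
          le_eqVal_trans (le_eqVal_symm (inf_le_right.trans hai))
            (le_eqVal_trans inf_le_left (inf_le_right.trans haj))
        rw [eqVal_check_of_ne (he.ne hij)] at h
        exact h.trans bot_le

/-- The elements of the von Neumann ordinal of a cardinal `α` are indexed by a type of cardinality
`α`. -/
theorem exists_embedding_range_eq_toZFSet (α : Cardinal.{u}) :
    ∃ e : α.ord.ToType ↪ ZFSet.{u}, ZFSet.range e = α.ord.toZFSet := by
  refine ⟨⟨fun a => (Ordinal.ToType.mk.symm a).1.toZFSet, fun a b h => ?_⟩, ?_⟩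
  · exact Ordinal.ToType.mk.symm.injective (Subtype.ext (Ordinal.toZFSet_injective h))
  · ext x
    rw [ZFSet.mem_range, Ordinal.mem_toZFSet_iff]
    constructor
    · rintro ⟨a, rfl⟩
      exact ⟨_, (Ordinal.ToType.mk.symm a).2, rfl⟩
    · rintro ⟨o, ho, rfl⟩
      exact ⟨Ordinal.ToType.mk ⟨o, ho⟩,
        congrArg (fun a => a.1.toZFSet) (Ordinal.ToType.mk.symm_apply_apply ⟨o, ho⟩)⟩

theorem sizeVal_check_range {ι : Type u} {f : ι → ZFSet.{u}} (hf : Function.Injective f) :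
    sizeVal (Cardinal.mk ι) (check (ZFSet.range f) : BName B) = ⊤ := by
  obtain ⟨e, he⟩ := exists_embedding_range_eq_toZFSet (Cardinal.mk ι)
  obtain ⟨g⟩ : Nonempty ((Cardinal.mk ι).ord.ToType ≃ ι) :=
    Cardinal.eq.1 (Cardinal.mk_ord_toType _)
  have hr : ZFSet.range (f ∘ g) = ZFSet.range f := by
    ext x
    simp only [ZFSet.mem_range, Function.comp_apply, g.exists_congr_left, Equiv.apply_symm_apply]
  have h := bijVal_check_range (B := B) e.injective (hf.comp g.injective)
  rw [hr] at h
  rw [eq_top_iff, ← h, sizeVal, ← he]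
  exact le_iSup (fun k => bijVal k (check (ZFSet.range e)) (check (ZFSet.range f))) _

theorem bijVal_exists_image {Γ : B} {f x y a : BName B} (h : Γ ≤ bijVal f x y)
    (ha : Γ ≤ memVal a x) : Γ ≤ ⨆ b : BName B, memVal b y ⊓ memVal (opair a b) f :=
  le_of_le_himp (h.trans (inf_le_left.trans (inf_le_left.trans (inf_le_right.trans
    (iInf_le _ a))))) ha

theorem bijVal_inj {Γ : B} {f x y a b a' b' : BName B} (h : Γ ≤ bijVal f x y)
    (hab : Γ ≤ memVal (opair a b) f) (hab' : Γ ≤ memVal (opair a' b') f)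
    (hb : Γ ≤ eqVal b b') : Γ ≤ eqVal a a' := by
  have h1 := le_of_le_himp (h.trans (inf_le_right.trans ((iInf_le _ a).trans ((iInf_le _ b).trans
    ((iInf_le _ a').trans (iInf_le _ b')))))) (le_inf hab hab')
  exact (le_inf hb le_rfl).trans (le_bihimp_iff.1 h1).1

end BName

end Forcing

namespace Forcing

namespace BName

variable {B : Type u} [CompleteBooleanAlgebra B]

/-! ### The quotient name -/

theorem memVal_sep_check_range {ι : Type u} (φ : BName B → B) (f : ι → ZFSet.{u}) (z : BName B) :
    memVal z (sep φ (check (ZFSet.range f))) =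
      ⨆ i, φ (check (f i)) ⊓ eqVal z (check (f i)) := by
  have h : memVal z (sep φ (check (ZFSet.range f))) =
      ⨆ y : {y : ZFSet.{u} // y ∈ ZFSet.range f},
        φ (check y.1) ⊓ eqVal z (check y.1) := by
    rw [check, sep, memVal, ← (equivShrink {y : ZFSet.{u} // y ∈ ZFSet.range f}).iSup_comp]
    simp
  rw [h]
  apply le_antisymm
  · refine iSup_le fun ⟨y, hy⟩ => ?_
    obtain ⟨i, rfl⟩ := ZFSet.mem_range.1 hy
    exact le_iSup (fun i => φ (check (f i)) ⊓ eqVal z (check (f i))) i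
  · exact iSup_le fun i => le_iSup (fun y : {y // y ∈ ZFSet.range f} =>
      φ (check y.1) ⊓ eqVal z (check y.1)) ⟨f i, ZFSet.mem_range.2 ⟨i, rfl⟩⟩

theorem memVal_genericImage (h : Cond B → ZFSet.{u}) (z : BName B) :
    memVal z (genericImage h) = ⨆ p : Cond B, p.1 ⊓ eqVal z (check (h p)) := by
  rw [genericImage, memVal]

end BName

theorem pair_mem_orderSet {R : Type u} [Preorder R] (c : R ↪ ZFSet.{u}) {r s : R} :
    ZFSet.pair (c r) (c s) ∈ orderSet c ↔ r ≤ s := by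
  rw [orderSet, ZFSet.mem_range]
  constructor
  · rintro ⟨⟨⟨a, b⟩, hab⟩, h⟩
    obtain ⟨ha, hb⟩ := ZFSet.pair_inj.1 h
    rw [← c.injective ha, ← c.injective hb]
    exact hab
  · exact fun h => ⟨⟨(r, s), h⟩, rfl⟩

section Quotient

open BName

variable {B : Type u} [CompleteBooleanAlgebra B] {R : Type u} [Preorder R]

/-- The name for the quotient of the ground model poset `R` by the image of the generic filter
under `τ`, the elements of `R` being realised as sets through `c`. -/
noncomputable abbrev quotientName (c : R ↪ ZFSet.{u}) (τ : Cond B → R) : BName B :=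
  quotient (check (carrierSet c)) (check (orderSet c)) (genericImage fun p => c (τ p))

variable (c : R ↪ ZFSet.{u}) {τ : Cond B → R}

theorem le_compatVal_check {Γ : B} {r s : R} (h : Compat r s) :
    Γ ≤ compatVal (check (carrierSet c)) (check (orderSet c)) (check (c r)) (check (c s)) := by
  obtain ⟨t, hr, hs⟩ := h
  exact le_iSup_of_le (check (c t)) (le_inf (le_inf
    (le_memVal_check (ZFSet.mem_range.2 ⟨t, rfl⟩))
    (le_memVal_opair_check ((pair_mem_orderSet c).2 hr)))
    (le_memVal_opair_check ((pair_mem_orderSet c).2 hs)))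

theorem compat_of_le_compatVal {Γ : B} (hΓ : Γ ≠ ⊥) {r s : R}
    (h : Γ ≤ compatVal (check (carrierSet c)) (check (orderSet c)) (check (c r)) (check (c s))) :
    Compat r s := by
  obtain ⟨x, hx⟩ := exists_inf_ne_bot hΓ h
  set Δ : B := Γ ⊓ _
  have h1 : Δ ≤ _ := inf_le_right.trans (inf_le_left.trans inf_le_left)
  have h2 : Δ ≤ _ := inf_le_right.trans (inf_le_left.trans inf_le_right)
  have h3 : Δ ≤ _ := inf_le_right.trans inf_le_right
  rw [carrierSet, memVal_check_range] at h1
  obtain ⟨t, ht⟩ := exists_inf_ne_bot hx h1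
  have hxt : Δ ⊓ eqVal x (check (c t)) ≤ _ := inf_le_right
  exact ⟨t,
    (pair_mem_orderSet c).1 (pair_mem_of_le_memVal ht
      (memVal_congr_left (opair_congr hxt (le_eqVal_refl _)) (inf_le_left.trans h2))),
    (pair_mem_orderSet c).1 (pair_mem_of_le_memVal ht
      (memVal_congr_left (opair_congr hxt (le_eqVal_refl _)) (inf_le_left.trans h3)))⟩

theorem compatVal_congr_left {Γ : B} {S le x x' y : BName B} (h : Γ ≤ eqVal x x')
    (hx : Γ ≤ compatVal S le x y) : Γ ≤ compatVal S le x' y := by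
  refine le_of_le_iSup hx fun r => le_iSup_of_le r (le_inf (le_inf ?_ ?_) ?_)
  · exact inf_le_right.trans (inf_le_left.trans inf_le_left)
  · exact memVal_congr_left (opair_congr (le_eqVal_refl _) (inf_le_left.trans h))
      (inf_le_right.trans (inf_le_left.trans inf_le_right))
  · exact inf_le_right.trans inf_le_right

theorem le_carrierSet_of_le_quotientName {Γ : B} {z : BName B}
    (h : Γ ≤ memVal z (quotientName c τ)) : Γ ≤ ⨆ q : R, eqVal z (check (c q)) := by
  rw [quotientName, quotient, carrierSet, memVal_sep_check_range] at h
  exact h.trans (iSup_mono fun q => inf_le_right)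

/-- A reduct of `q` forces `q` into the quotient. -/
theorem le_memVal_quotientName (hτ : Monotone τ) {p : Cond B} {q : R}
    (h : ∀ p' ≤ p, Compat (τ p') q) : p.1 ≤ memVal (check (c q)) (quotientName c τ) := by
  rw [quotientName, quotient, carrierSet, memVal_sep_check_range]
  refine le_iSup_of_le q (le_inf (le_iInf fun x => le_himp_iff.2 ?_) (le_eqVal_refl _))
  rw [memVal_genericImage]
  refine le_of_le_iSup inf_le_right fun s => ?_
  by_cases hs : p.1 ⊓ s.1 = ⊥
  · exact le_trans (le_inf (inf_le_left.trans inf_le_left) (inf_le_right.trans inf_le_left))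
      (hs.le.trans bot_le)
  · obtain ⟨t, ht, htq⟩ := h ⟨p.1 ⊓ s.1, hs⟩ inf_le_left
    have hts : (⟨p.1 ⊓ s.1, hs⟩ : Cond B) ≤ s := inf_le_right
    exact compatVal_congr_left (le_eqVal_symm (inf_le_right.trans inf_le_right))
      (le_compatVal_check c ⟨t, ht.trans (hτ hts), htq⟩)

/-- A condition forcing `q` into the quotient has its image compatible with `q`. -/
theorem compat_of_le_quotientName {p : Cond B} {q : R}
    (h : p.1 ≤ memVal (check (c q)) (quotientName c τ)) : Compat (τ p) q := by
  rw [quotientName, quotient, carrierSet, memVal_sep_check_range] at h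
  obtain ⟨q', hq'⟩ := exists_inf_ne_bot p.2 h
  obtain rfl : q = q' :=
    c.injective (eq_of_le_eqVal_check hq' (inf_le_right.trans inf_le_right))
  refine compat_of_le_compatVal c hq' (le_of_le_himp
    (inf_le_right.trans (inf_le_left.trans (iInf_le _ (check (c (τ p)))))) ?_)
  rw [memVal_genericImage]
  exact le_iSup_of_le p (le_inf inf_le_left (le_eqVal_refl _))

end Quotient

/-! ### Bounded subfamilies of size `μ` -/

/-- Let `q` be a family of size `κ` with a refinement `r`. Either `r` takes `κ` many values, and
the chain condition applies to its range; or, `κ` being regular, `r` is constant on a set of `κ`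
many indices, and the chain condition, applied to the values of `q` there, gives `μ ≤ κ`. -/
theorem HasCC.exists_bounded_subfamily {R ι : Type u} [Preorder R] {κ μ : Cardinal.{u}}
    (hR : HasCC R κ μ μ) (hκ : κ.IsRegular) (hι : Cardinal.mk ι = κ) {q r : ι → R}
    (hinj : ∀ s : R, Set.InjOn q {i | s ≤ r i}) :
    ∃ I : Set ι, Cardinal.mk I = μ ∧ ∃ s : R, ∀ i ∈ I, s ≤ r i := by
  have hle : Cardinal.mk (Set.range r) ≤ κ := hι ▸ Cardinal.mk_range_le
  rcases hle.lt_or_eq with hlt | heq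
  · obtain ⟨⟨a, ha⟩, hJ⟩ := Cardinal.infinite_pigeonhole (Set.rangeFactorization r)
      (hι ▸ hκ.aleph0_le) (by rwa [hι, hκ.cof_ord])
    set J := Set.rangeFactorization r ⁻¹' {⟨a, ha⟩}
    have hJa : ∀ i ∈ J, r i = a := fun i hi => congrArg Subtype.val hi
    have hcard : Cardinal.mk (q '' J) = κ := by
      rw [Cardinal.mk_image_eq_of_injOn _ _ ((hinj a).mono fun i hi => (hJa i hi).ge), hJ, hι]
    obtain ⟨A, hA, hAμ, -⟩ := hR _ hcard
    have hμ : μ ≤ Cardinal.mk J := by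
      rw [hJ, hι, ← hAμ, ← hcard]
      exact Cardinal.mk_le_mk_of_subset hA
    obtain ⟨I, hIJ, hI⟩ := Cardinal.le_mk_iff_exists_subset.1 hμ
    exact ⟨I, hI, a, fun i hi => (hJa i (hIJ hi)).ge⟩
  · obtain ⟨A, hA, hAμ, hs⟩ := hR _ heq
    obtain ⟨s, hs⟩ := hs A subset_rfl hAμ
    obtain ⟨I, hI, hinjI⟩ := Set.exists_image_eq_injOn_of_subset_range hA
    refine ⟨I, ?_, s, fun i hi => hs _ (hI ▸ Set.mem_image_of_mem r hi)⟩
    rw [← hAμ, ← hI, Cardinal.mk_image_eq_of_injOn _ _ hinjI]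

/-! ### The chain condition of the quotient -/

section ChainCondition

open BName

variable {P Q : Type u} [CompleteBooleanAlgebra P] [CompleteBooleanAlgebra Q]

/-- By separativity, a reduct of `q` extends every condition whose image is above `q`. -/
theorem IsCompleteEmbedding.le_of_reduct {τ : Cond P → Cond Q} (hτ : IsCompleteEmbedding τ)
    {p s : Cond P} {q : Cond Q} (hp : ∀ p' ≤ p, Compat (τ p') q) (hq : q ≤ τ s) : p ≤ s := by
  by_contra hps
  have hd : p.1 \ s.1 ≠ ⊥ := fun h => hps (sdiff_eq_bot_iff.1 h)
  obtain ⟨t, ht, htq⟩ := hp ⟨_, hd⟩ sdiff_le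
  exact compat_iff_inf_ne_bot.1 ((hτ.compat_iff ⟨_, hd⟩ s).1 ⟨t, ht, htq.trans hq⟩)
    disjoint_sdiff_self_left.eq_bot

/-- Below a condition `b` forcing that `f` is a bijection of `x` onto a subset of the quotient,
each value of `f` is decided by some condition to be a ground model element. -/
theorem exists_decided_value (c : Cond Q ↪ ZFSet.{u}) {τ : Cond P → Cond Q} {b : P} (hb : b ≠ ⊥)
    {A f x : BName P} (hA : b ≤ subVal A (quotientName c τ)) (hf : b ≤ bijVal f x A)
    {a : BName P} (ha : b ≤ memVal a x) :
    ∃ s : Cond P, ∃ q : Cond Q, s.1 ≤ b ∧ s.1 ≤ memVal (check (c q)) A ∧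
      s.1 ≤ memVal (opair a (check (c q))) f := by
  obtain ⟨y, hy⟩ := exists_inf_ne_bot hb (bijVal_exists_image hf ha)
  set Γ : P := b ⊓ (memVal y A ⊓ memVal (opair a y) f)
  have hyA : Γ ≤ memVal y A := inf_le_right.trans inf_le_left
  have hyf : Γ ≤ memVal (opair a y) f := inf_le_right.trans inf_le_right
  obtain ⟨q, hq⟩ := exists_inf_ne_bot hy
    (le_carrierSet_of_le_quotientName c (subVal_elim (inf_le_left.trans hA) hyA))
  exact ⟨⟨_, hq⟩, q, inf_le_left.trans inf_le_left,
    memVal_congr_left inf_le_right (inf_le_left.trans hyA),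
    memVal_congr_left (opair_congr (le_eqVal_refl _) inf_le_right) (inf_le_left.trans hyf)⟩

end ChainCondition

end Forcing

open Forcing Forcing.BName in
theorem lemma4p4 {P Q : Type u} [CompleteBooleanAlgebra P] [CompleteBooleanAlgebra Q]
    (κ μ : Cardinal.{u}) (hκ : κ.IsRegular) (hμ : μ.IsRegular)
    (τ : Forcing.Cond P → Forcing.Cond Q) (hτ : Forcing.IsCompleteEmbedding τ)
    (hQ : Forcing.HasCC (Forcing.Cond Q) κ μ μ)
    (c : Forcing.Cond Q ↪ ZFSet.{u}) (p : Forcing.Cond P) :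
    Forcing.Forces p
      (Forcing.BName.ccVal
        (Forcing.BName.quotient
          (Forcing.BName.check (Forcing.carrierSet c))
          (Forcing.BName.check (Forcing.orderSet c))
          (Forcing.BName.genericImage (fun p => c (τ p))))
        (Forcing.BName.check (Forcing.orderSet c)) κ μ μ) := by
  refine le_iInf fun A => le_himp_iff.2 (inf_le_right.trans (le_of_dense fun b₀ hb₀ hb₀A => ?_))
  obtain ⟨f, hb⟩ := exists_inf_ne_bot hb₀ (hb₀A.trans inf_le_right)
  set b : P := b₀ ⊓ _
  have hbA : b ≤ subVal A (quotientName c τ) := inf_le_left.trans (hb₀A.trans inf_le_left)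
  have hbf : b ≤ bijVal f (check κ.ord.toZFSet) A := inf_le_right
  obtain ⟨e, he⟩ := exists_embedding_range_eq_toZFSet κ
  have hdec := fun i => exists_decided_value c hb hbA hbf
    (le_memVal_check (he ▸ ZFSet.mem_range.2 ⟨i, rfl⟩ : e i ∈ κ.ord.toZFSet))
  choose s q hsb hqA hqf using hdec
  have hcompat : ∀ i, Compat (τ (s i)) (q i) := fun i =>
    compat_of_le_quotientName c (subVal_elim ((hsb i).trans hbA) (hqA i))
  choose r hrs hrq using hcompat
  -- A reduct of a common lower bound of some `r i` forces all corresponding `s i` into the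
  -- generic filter, hence decides the bijection `f` at these `i`.
  have hinj : ∀ t : Cond Q, Set.InjOn q {i | t ≤ r i} := by
    intro t i hi j hj hij
    obtain ⟨p', hp'⟩ := hτ.exists_reduct t
    have hle : ∀ k, t ≤ r k → p'.1 ≤ (s k).1 := fun k hk => hτ.le_of_reduct hp' (hk.trans (hrs k))
    refine e.injective (eq_of_le_eqVal_check p'.2 (bijVal_inj
      (((hle i hi).trans (hsb i)).trans hbf)
      ((hle i hi).trans (hqf i)) ((hle j hj).trans (hqf j)) ?_))
    rw [hij]
    exact le_eqVal_refl _
  obtain ⟨I, hI, t, ht⟩ :=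
    hQ.exists_bounded_subfamily hκ (Cardinal.mk_ord_toType κ) hinj
  obtain ⟨p', hp'⟩ := hτ.exists_reduct t
  have hle : ∀ i ∈ I, p'.1 ≤ (s i).1 := fun i hi => hτ.le_of_reduct hp' ((ht i hi).trans (hrs i))
  obtain ⟨⟨i₀, hi₀⟩⟩ : Nonempty I :=
    Cardinal.mk_ne_zero_iff.1 (hI ▸ hμ.pos.ne')
  have hqinj : Function.Injective fun i : I => c (q i) := fun i j hij =>
    Subtype.ext (hinj t (ht i i.2) (ht j j.2) (c.injective hij))
  -- The required subset `Y` of `A` is the ground model set of the values `q i` with `i ∈ I`.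
  refine ⟨p'.1, (hle i₀ hi₀).trans ((hsb i₀).trans inf_le_left), p'.2,
    le_iSup_of_le (check (ZFSet.range fun i : I => c (q i))) (le_inf (le_inf ?_ ?_) ?_)⟩
  · refine le_iInf fun z => le_himp_iff.2 ?_
    rw [memVal_check_range]
    exact le_of_le_iSup inf_le_right fun i => memVal_congr_left (le_eqVal_symm inf_le_right)
      (inf_le_left.trans (inf_le_left.trans ((hle i i.2).trans (hqA i))))
  · rw [← hI, sizeVal_check_range hqinj]
    exact le_top
  · -- The bound `t` works for every subset of `Y` in the extension, whatever its size; `p'` forces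
    -- it into the quotient because `p'` is a reduct of `t`.
    refine le_iInf fun X => le_himp_iff.2 (le_iSup_of_le (check (c t)) (le_inf ?_ ?_))
    · exact inf_le_left.trans (le_memVal_quotientName c (fun p p' => hτ.mono p p') hp')
    · refine le_iInf fun x => le_himp_iff.2 ?_
      have hx := subVal_elim (inf_le_left.trans (inf_le_right.trans inf_le_left)) (inf_le_right :
        p'.1 ⊓ (subVal X (check (ZFSet.range fun i : I => c (q i))) ⊓ sizeVal μ X) ⊓ memVal x X ≤ _)
      rw [memVal_check_range] at hx
      exact le_of_le_iSup hx fun i => memVal_congr_left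
        (opair_congr (le_eqVal_refl _) (le_eqVal_symm inf_le_right))
        (le_memVal_opair_check ((pair_mem_orderSet c).2 ((ht i i.2).trans (hrq i))))
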